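/- For each index $k$ of a limiting process let $Z$ be a random observation with law $P$ on a measurable space, let $\Lambda$ be an index set, and let $Q(\cdot,\alpha)$, $\alpha\in\Lambda$, be measurable loss functions; all of these, as well as the integers $h,n,m$ below, may vary with $k$. Assume $0\le Q(z,\alpha)\le B$ for a constant $B$ that does not depend on $k$. Let $h$ be the VC dimension of $\{Q(\cdot,\alpha):\alpha\in\Lambda\}$, that is, the largest number of points that can be shattered by the level sets $\{z: Q(z,\alpha)\ge\beta\}$, $\alpha\in\Lambda$, $\beta\in\mathbb{R}$ (assumed finite for every $k$). Put $$D_2(\alpha)=\int_0^\infty \sqrt{P\{Q(Z,\alpha)\ge c\}}\,dc,\qquad D_2(\alpha^*)=\sup_{\alpha\in\Lambda}D_2(\alpha),$$ and assume that $D_2(\alpha^*)\ge\delta$ for a constant $\delta>0$ that does not depend on $k$. Let $Z_1,\dots,Z_{2n}$ be independent with law $P$, and let $$\nu_1(\alpha)=\frac1n\sum_{i=1}^{n}Q(Z_i,\alpha),\qquad \nu_2(\alpha)=\frac1n\sum_{i=n+1}^{2n}Q(Z_i,\alpha)$$ be the empirical losses on the two halves of the sample. If $h\to\infty$, $n/h\to\infty$,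 $m\to\infty$ and $\ln m=o(n)$ along the limiting process ($m$ is an auxiliary discretization parameter, which does not occur in the conclusion), then eventually $$E\sup_{\alpha\in\Lambda}\bigl|\nu_1(\alpha)-\nu_2(\alpha)\bigr|\le\min\bigl(1,\,8D_2(\alpha^*)\bigr)\sqrt{\frac hn\ln\frac{2ne}{h}}.$$ -/

import Mathlib

open MeasureTheory Filter Asymptotics
open scoped ENNReal

namespace EmpLoss

/-- The finite set `S` is shattered by the level sets `{z | β ≤ Q z α}` (`α : Λ`, `β : ℝ`):
every subset `T` of `S` is cut out of `S` by one of them. -/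
def LevelShatters {𝒵 Λ : Type*} (Q : 𝒵 → Λ → ℝ) (S : Finset 𝒵) : Prop :=
  ∀ T ⊆ S, ∃ (α : Λ) (β : ℝ), ∀ z ∈ S, z ∈ T ↔ β ≤ Q z α

/-- The VC dimension of a class of real functions `Q (·, α)`, `α : Λ`: the VC dimension of the
class of indicators of all its level sets, i.e. the largest size of a shattered set. -/
noncomputable def vcDim {𝒵 Λ : Type*} (Q : 𝒵 → Λ → ℝ) : ℕ∞ :=
  ⨆ (S : Finset 𝒵) (_ : LevelShatters Q S), (S.card : ℕ∞)

/-- `D_p(α) = ∫₀^∞ P{z | Q(z, α) ≥ c}^(1/p) dc`, as an element of `[0, ∞]`. -/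
noncomputable def tailNorm {𝒵 Λ : Type*} [MeasurableSpace 𝒵] (P : Measure 𝒵)
    (Q : 𝒵 → Λ → ℝ) (p : ℝ) (α : Λ) : ℝ≥0∞ :=
  ∫⁻ c in Set.Ioi (0 : ℝ), (P {z | c ≤ Q z α}) ^ (1 / p)

/-- `D_p(α*) = sup_α D_p(α)`; the supremum need not be attained. -/
noncomputable def tailNormSup {𝒵 Λ : Type*} [MeasurableSpace 𝒵] (P : Measure 𝒵)
    (Q : 𝒵 → Λ → ℝ) (p : ℝ) : ℝ≥0∞ :=
  ⨆ α : Λ, tailNorm P Q p α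

/-- Empirical loss on the first half of a sample of size `2n`. -/
noncomputable def empLoss₁ {𝒵 Λ : Type*} (Q : 𝒵 → Λ → ℝ) {n : ℕ} (z : Fin (n + n) → 𝒵)
    (α : Λ) : ℝ :=
  (1 / (n : ℝ)) * ∑ i : Fin n, Q (z (Fin.castAdd n i)) α

/-- Empirical loss on the second half of a sample of size `2n`. -/
noncomputable def empLoss₂ {𝒵 Λ : Type*} (Q : 𝒵 → Λ → ℝ) {n : ℕ} (z : Fin (n + n) → 𝒵)
    (α : Λ) : ℝ :=
  (1 / (n : ℝ)) * ∑ i : Fin n, Q (z (Fin.natAdd n i)) α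

/-- `E sup_α |ν₁(Z₁, α) - ν₂(Z₂, α)|` for `2n` independent observations with law `P`. -/
noncomputable def expSupDiff {𝒵 Λ : Type*} [MeasurableSpace 𝒵] (P : Measure 𝒵)
    (Q : 𝒵 → Λ → ℝ) (n : ℕ) : ℝ≥0∞ :=
  ∫⁻ z : Fin (n + n) → 𝒵, (⨆ α : Λ, ENNReal.ofReal |empLoss₁ Q z α - empLoss₂ Q z α|)
    ∂(Measure.pi fun _ : Fin (n + n) => P)

end EmpLoss

/-! Since `min 1 (8 * D₂)` is at least the fixed constant `min 1 (8 * δ) > 0`, it suffices that the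
expected supremum is o(√((h/n) ln(2ne/h))), uniformly over all classes bounded by `B`.
Symmetrization reduces this to Rademacher sums, and the layer-cake formula replaces losses by traces
of level sets on the sample. A union bound over Sauer's (2ne/h)^h traces gives only a constant times
the rate, so the traces are chained in two steps. An ε-net has at most (et)^h members with t
depending on ε alone (`card_separated_le`), which costs O(√(h/n)) without the logarithm. Passing
from a trace to the net involves vectors of norm O(√(εn)), which costs O(√ε) times the rate
(`sum_signs_levelFamily_le`). Taking ε small and then n/h large makes the constant any η > 0
(`exists_expSupDiff_le`). -/

namespace EmpLoss

/-! ### Traces of level sets and Sauer's bound -/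

/-- The traces of the level sets `{c ≤ Q · a}` on a finite sequence of points. -/
noncomputable def levelFamily {𝒵 Λ β : Type*} [Fintype β] (Q : 𝒵 → Λ → ℝ) (z : β → 𝒵) :
    Finset (Finset β) := by
  classical
  exact Finset.univ.filter fun A => ∃ (a : Λ) (c : ℝ), ∀ i, i ∈ A ↔ c ≤ Q (z i) a

theorem mem_levelFamily {𝒵 Λ β : Type*} [Fintype β] {Q : 𝒵 → Λ → ℝ} {z : β → 𝒵}
    {A : Finset β} :
    A ∈ levelFamily Q z ↔ ∃ (a : Λ) (c : ℝ), ∀ i, i ∈ A ↔ c ≤ Q (z i) a := by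
  classical
  simp [levelFamily]

/-- No trace separates two positions carrying the same point, so `z` is injective on a shattered set
of positions and its image is shattered by level sets. -/
theorem vcDim_levelFamily_le {𝒵 Λ β : Type*} [Fintype β] [DecidableEq β] {Q : 𝒵 → Λ → ℝ}
    {h : ℕ} (hVC : vcDim Q ≤ h) (z : β → 𝒵) : (levelFamily Q z).vcDim ≤ h := by
  classical
  refine Finset.sup_le fun T hT => ?_
  rw [Finset.mem_shatterer] at hT
  have hinj : Set.InjOn z T := by
    intro i hi j hj hij
    obtain ⟨u, hu, hTu⟩ := hT (Finset.singleton_subset_iff.2 hi)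
    obtain ⟨a, c, hac⟩ := mem_levelFamily.1 hu
    have h1 : i ∈ T ∩ u := by rw [hTu]; simp
    have h2 : i ∈ u := (Finset.mem_inter.1 h1).2
    have h3 : j ∈ u := by rw [hac, ← hij, ← hac]; exact h2
    have h4 : j ∈ T ∩ u := Finset.mem_inter.2 ⟨hj, h3⟩
    rw [hTu] at h4
    exact (Finset.mem_singleton.1 h4).symm
  have hsh : LevelShatters Q (T.image z) := by
    intro S hS
    obtain ⟨u, hu, hTu⟩ := hT (Finset.filter_subset (fun i => z i ∈ S) T)
    obtain ⟨a, c, hac⟩ := mem_levelFamily.1 hu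
    refine ⟨a, c, fun y hy => ?_⟩
    obtain ⟨i, hi, rfl⟩ := Finset.mem_image.1 hy
    rw [← hac]
    have : i ∈ T ∩ u ↔ i ∈ T.filter (fun i => z i ∈ S) := by rw [hTu]
    simp only [Finset.mem_inter, Finset.mem_filter, hi, true_and] at this
    exact this.symm
  have hle : ((T.image z).card : ℕ∞) ≤ vcDim Q := le_iSup₂ (f := fun (S : Finset 𝒵)
    (_ : LevelShatters Q S) => (S.card : ℕ∞)) (T.image z) hsh
  rw [Finset.card_image_of_injOn hinj] at hle
  exact_mod_cast hle.trans hVC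

/-- Weighting each term by (N/h)^(h-k) ≥ 1 completes the sum to a binomial expansion, and (1 +
h/N)^N ≤ e^h. -/
theorem sum_choose_le {h N : ℕ} (hh : 1 ≤ h) (hN : h ≤ N) :
    ((∑ k ∈ Finset.Iic h, N.choose k : ℕ) : ℝ) ≤ (Real.exp 1 * N / h) ^ h := by
  have hh0 : (0 : ℝ) < h := by exact_mod_cast hh
  have hN0 : (0 : ℝ) < N := lt_of_lt_of_le hh0 (by exact_mod_cast hN)
  have hx : (1 : ℝ) ≤ N / h := by rw [le_div_iff₀ hh0]; simpa using (by exact_mod_cast hN)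
  have h1 : ((∑ k ∈ Finset.Iic h, N.choose k : ℕ) : ℝ)
      ≤ ∑ k ∈ Finset.Iic h, (N / h : ℝ) ^ h * ((h / N : ℝ) ^ k * N.choose k) := by
    push_cast
    refine Finset.sum_le_sum fun k hk => ?_
    have hk' : k ≤ h := Finset.mem_Iic.1 hk
    rw [← mul_assoc]
    refine le_mul_of_one_le_left (by positivity) ?_
    have : (N / h : ℝ) ^ h * (h / N : ℝ) ^ k = (N / h : ℝ) ^ (h - k) := by
      rw [← pow_sub_mul_pow _ hk', mul_assoc, ← mul_pow, div_mul_div_cancel₀ hh0.ne',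
        div_self hN0.ne', one_pow, mul_one]
    rw [this]
    exact one_le_pow₀ hx
  have h2 : ∑ k ∈ Finset.Iic h, (N / h : ℝ) ^ h * ((h / N : ℝ) ^ k * N.choose k)
      ≤ (N / h : ℝ) ^ h * (h / N + 1) ^ N := by
    rw [← Finset.mul_sum, add_pow]
    refine mul_le_mul_of_nonneg_left ?_ (by positivity)
    simp only [one_pow, mul_one]
    refine Finset.sum_le_sum_of_subset_of_nonneg ?_ fun _ _ _ => by positivity
    intro k hk
    have := Finset.mem_Iic.1 hk
    exact Finset.mem_range.2 (by omega)
  have h3 : ((h : ℝ) / N + 1) ^ N ≤ Real.exp 1 ^ h := by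
    calc ((h : ℝ) / N + 1) ^ N ≤ Real.exp (h / N) ^ N := by
          gcongr; exact Real.add_one_le_exp _
      _ = Real.exp 1 ^ h := by
          rw [← Real.exp_nat_mul, ← Real.exp_nat_mul]; congr 1; field_simp
  calc _ ≤ _ := h1
    _ ≤ _ := h2
    _ ≤ (N / h : ℝ) ^ h * Real.exp 1 ^ h := by gcongr
    _ = _ := by rw [← mul_pow]; congr 1; ring

/-- Sauer's bound for the number of traces of level sets. -/
theorem card_levelFamily_le {𝒵 Λ β : Type*} [Fintype β] {Q : 𝒵 → Λ → ℝ}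
    {h : ℕ} (hVC : vcDim Q ≤ h) (hh : 1 ≤ h) (hβ : h ≤ Fintype.card β) (z : β → 𝒵) :
    ((levelFamily Q z).card : ℝ) ≤ (Real.exp 1 * Fintype.card β / h) ^ h := by
  classical
  refine le_trans ?_ (sum_choose_le hh hβ)
  have h1 := (levelFamily Q z).card_le_card_shatterer.trans Finset.card_shatterer_le_sum_vcDim
  refine Nat.cast_le.2 (h1.trans (Finset.sum_le_sum_of_subset ?_))
  exact Finset.Iic_subset_Iic.2 (vcDim_levelFamily_le hVC z)

/-! ### Packing numbers and nets -/

/-- A family of traces that are pairwise far apart remains distinct on a small random sample,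
hence has few members. -/
theorem card_separated_le {𝒵 Λ β : Type*} [Fintype β] [DecidableEq β] [Nonempty β]
    {Q : 𝒵 → Λ → ℝ} {h : ℕ} (hVC : vcDim Q ≤ h) (hh : 1 ≤ h) (z : β → 𝒵) {ε : ℝ}
    {t : ℕ} (ht1 : 1 ≤ t) (ht : (2 * Real.exp 1 * t) ^ 2 < Real.exp (ε * t))
    {G : Finset (Finset β)} (hG : G ⊆ levelFamily Q z)
    (hsep : ∀ A ∈ G, ∀ A' ∈ G, A ≠ A' → ε * Fintype.card β ≤ (symmDiff A A').card) :
    (G.card : ℝ) ≤ (Real.exp 1 * t) ^ h := by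
  classical
  by_contra! hcon
  have ht0 : (1 : ℝ) ≤ t := by exact_mod_cast ht1
  have he : (1 : ℝ) ≤ Real.exp 1 := Real.one_le_exp zero_le_one
  have het : (1 : ℝ) ≤ Real.exp 1 * t := one_le_mul_of_one_le_of_one_le he ht0
  set x : ℝ := (Real.exp 1 * t) ^ h with hx
  have hx1 : 1 ≤ x := one_le_pow₀ het
  -- Trimming `G` to just above the claimed bound keeps the number of pairs small enough for the
  -- union bound below.
  obtain ⟨G₀, hG₀, hcard⟩ : ∃ G₀ ⊆ G, G₀.card = ⌊x⌋₊ + 1 :=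
    Finset.exists_subset_card_eq (Nat.succ_le_of_lt ((Nat.floor_lt (by linarith)).2 hcon))
  have hlow : x < G₀.card := by rw [hcard]; push_cast; exact Nat.lt_floor_add_one x
  have hupp : (G₀.card : ℝ) ≤ (2 * Real.exp 1 * t) ^ h := by
    have h1 : (G₀.card : ℝ) ≤ x + 1 := by
      rw [hcard]; push_cast; gcongr; exact Nat.floor_le (by linarith)
    have h2 : (2 : ℝ) ≤ 2 ^ h := by
      simpa using pow_le_pow_right₀ (by norm_num : (1 : ℝ) ≤ 2) hh
    rw [mul_assoc, mul_pow]
    nlinarith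
  set N : ℝ := (Fintype.card β : ℝ) with hN
  have hN0 : 0 < N := by rw [hN]; exact_mod_cast Fintype.card_pos
  -- The samples of `h * t` positions that fail to distinguish the pair; their proportion is at most
  -- (1 - ε)^(ht).
  let bad : Finset β × Finset β → Finset (Fin (h * t) → β) := fun p =>
    Fintype.piFinset fun _ => (symmDiff p.1 p.2)ᶜ
  have hbad : ∀ p ∈ G₀.offDiag, ((bad p).card : ℝ) ≤ N ^ (h * t) * (Real.exp (-(ε * t))) ^ h := by
    intro p hp
    obtain ⟨hp1, hp2, hp3⟩ := Finset.mem_offDiag.1 hp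
    have h1 := hsep _ (hG₀ hp1) _ (hG₀ hp2) hp3
    have h2 : (((symmDiff p.1 p.2)ᶜ).card : ℝ) ≤ N * Real.exp (-ε) := by
      rw [Finset.card_compl, Nat.cast_sub (Finset.card_le_univ _), ← hN]
      have := Real.add_one_le_exp (-ε)
      nlinarith
    have h3 : (bad p).card = ((symmDiff p.1 p.2)ᶜ).card ^ (h * t) :=
      Fintype.card_piFinset_const _ _
    rw [h3]; push_cast
    calc _ ≤ (N * Real.exp (-ε)) ^ (h * t) := by gcongr
      _ = _ := by
        rw [mul_pow]; congr 1
        rw [mul_comm h t, pow_mul]; congr 1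
        rw [← Real.exp_nat_mul]; congr 1; ring
  -- Union bound over at most ((2et)²)^h pairs; `ht` makes the total proportion less than 1.
  obtain ⟨f, hf⟩ : ∃ f, f ∉ G₀.offDiag.biUnion bad := by
    by_contra! hall
    have h1 : (G₀.offDiag.biUnion bad) = Finset.univ :=
      Finset.eq_univ_iff_forall.2 hall
    have h2 : ((G₀.offDiag.biUnion bad).card : ℝ) = N ^ (h * t) := by
      rw [h1, Finset.card_univ]; simp [hN]
    have h3 : ((G₀.offDiag.biUnion bad).card : ℝ) ≤ ∑ p ∈ G₀.offDiag, ((bad p).card : ℝ) := by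
      exact_mod_cast Finset.card_biUnion_le
    have h4 := h3.trans (Finset.sum_le_sum hbad)
    rw [h2, Finset.sum_const, nsmul_eq_mul] at h4
    have h5 : (G₀.offDiag.card : ℝ) ≤ ((2 * Real.exp 1 * t) ^ 2) ^ h := by
      have : (G₀.offDiag.card : ℝ) ≤ (G₀.card : ℝ) ^ 2 := by
        rw [Finset.offDiag_card, sq]; exact_mod_cast Nat.sub_le _ _
      refine this.trans ?_
      rw [pow_right_comm]
      gcongr
    have h6 : ((2 * Real.exp 1 * t) ^ 2) ^ h * (Real.exp (-(ε * t))) ^ h < 1 := by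
      rw [← mul_pow]
      refine pow_lt_one₀ (by positivity) ?_ (by omega)
      rw [Real.exp_neg, ← div_eq_mul_inv, div_lt_one (Real.exp_pos _)]
      exact ht
    have h7 : (0 : ℝ) < N ^ (h * t) := by positivity
    have h8 : (G₀.offDiag.card : ℝ) * (N ^ (h * t) * (Real.exp (-(ε * t))) ^ h) ≤
        N ^ (h * t) * (((2 * Real.exp 1 * t) ^ 2) ^ h * (Real.exp (-(ε * t))) ^ h) := by
      calc _ ≤ ((2 * Real.exp 1 * t) ^ 2) ^ h * (N ^ (h * t) * (Real.exp (-(ε * t))) ^ h) := by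
            gcongr
        _ = _ := by ring
    nlinarith
  -- Traces stay distinct along `f`, so Sauer's bound on `h * t` points contradicts `hlow`.
  let g : Finset β → Finset (Fin (h * t)) := fun A => Finset.univ.filter fun j => f j ∈ A
  have hginj : Set.InjOn g G₀ := by
    intro A hA A' hA' hAA
    by_contra hne
    apply hf
    refine Finset.mem_biUnion.2 ⟨(A, A'), Finset.mem_offDiag.2 ⟨hA, hA', hne⟩, ?_⟩
    refine Fintype.mem_piFinset.2 fun j => ?_
    have : j ∈ g A ↔ j ∈ g A' := by rw [hAA]
    simp only [g, Finset.mem_filter, Finset.mem_univ, true_and] at this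
    simp only [Finset.mem_compl, Finset.mem_symmDiff]
    tauto
  have hgsub : G₀.image g ⊆ levelFamily Q (z ∘ f) := by
    intro u hu
    obtain ⟨A, hA, rfl⟩ := Finset.mem_image.1 hu
    obtain ⟨a, c, hac⟩ := mem_levelFamily.1 (hG (hG₀ hA))
    exact mem_levelFamily.2 ⟨a, c, fun j => by simp [g, hac]⟩
  have h1 := Finset.card_le_card hgsub
  rw [Finset.card_image_of_injOn hginj] at h1
  have h2 := card_levelFamily_le hVC hh (by simpa using Nat.le_mul_of_pos_right h ht1) (z ∘ f)
  have h3 : Real.exp 1 * (Fintype.card (Fin (h * t)) : ℝ) / h = Real.exp 1 * t := by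
    have : (h : ℝ) ≠ 0 := by positivity
    simp only [Fintype.card_fin, Nat.cast_mul]
    field_simp
  rw [h3] at h2
  have h4 : (G₀.card : ℝ) ≤ (levelFamily Q (z ∘ f)).card := by exact_mod_cast h1
  linarith

/-- Every finite set contains a maximal `r`-separated subset. -/
theorem exists_separated_net {γ : Type*} (r : γ → γ → Prop) (hr : ∀ x, r x x)
    (hs : ∀ x y, r x y → r y x) (F : Finset γ) :
    ∃ G ⊆ F, (∀ x ∈ G, ∀ y ∈ G, x ≠ y → ¬ r x y) ∧ ∀ x ∈ F, ∃ y ∈ G, r x y := by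
  classical
  induction F using Finset.induction_on with
  | empty => exact ⟨∅, by simp⟩
  | insert a F _ ih =>
    obtain ⟨G, hGF, hsep, hcov⟩ := ih
    by_cases hex : ∃ y ∈ G, r a y
    · refine ⟨G, hGF.trans (Finset.subset_insert _ _), hsep, fun x hx => ?_⟩
      rcases Finset.mem_insert.1 hx with rfl | hx
      exacts [hex, hcov x hx]
    · push Not at hex
      refine ⟨insert a G, Finset.insert_subset_insert _ hGF, ?_, ?_⟩
      · intro x hx y hy hxy
        rcases Finset.mem_insert.1 hx with rfl | hx' <;>
          rcases Finset.mem_insert.1 hy with rfl | hy'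
        · exact absurd rfl hxy
        · exact hex y hy'
        · exact fun hh => hex x hx' (hs _ _ hh)
        · exact hsep x hx' y hy' hxy
      · intro x hx
        rcases Finset.mem_insert.1 hx with rfl | hx
        · exact ⟨x, Finset.mem_insert_self _ _, hr x⟩
        · obtain ⟨y, hy, hxy⟩ := hcov x hx
          exact ⟨y, Finset.mem_insert_of_mem hy, hxy⟩

/-! ### Rademacher sums over finite classes -/

/-- The sign `±1` coded by a Boolean. -/
def boolSign (b : Bool) : ℝ := if b then 1 else -1

theorem sum_exp_signs {n : ℕ} (a : Fin n → ℝ) :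
    ∑ σ : Fin n → Bool, Real.exp (∑ i, boolSign (σ i) * a i) ≤
      2 ^ n * Real.exp ((∑ i, a i ^ 2) / 2) := by
  have h1 : ∑ σ : Fin n → Bool, Real.exp (∑ i, boolSign (σ i) * a i) =
      ∏ i, ∑ b : Bool, Real.exp (boolSign b * a i) := by
    rw [Finset.prod_univ_sum, Fintype.piFinset_univ]
    exact Finset.sum_congr rfl fun σ _ => Real.exp_sum _ _
  have h2 : ∀ i, ∑ b : Bool, Real.exp (boolSign b * a i) ≤ 2 * Real.exp (a i ^ 2 / 2) := by
    intro i
    have := Real.cosh_le_exp_half_sq (a i)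
    rw [Real.cosh_eq] at this
    simp [boolSign]
    linarith
  rw [h1]
  calc _ ≤ ∏ i, 2 * Real.exp (a i ^ 2 / 2) :=
        Finset.prod_le_prod (fun i _ => by positivity) fun i _ => h2 i
    _ = _ := by
      rw [Finset.prod_mul_distrib, ← Real.exp_sum, Finset.sum_div]; simp

/-- Massart's finite class lemma for Rademacher averages. -/
theorem sum_signs_le {n : ℕ} {γ : Type*} (S : Finset γ) (hS : S.Nonempty) (x : γ → Fin n → ℝ)
    {r : ℝ} (hr : 0 < r) (hx : ∀ s ∈ S, ∑ i, x s i ^ 2 ≤ r ^ 2) (p : (Fin n → Bool) → γ)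
    (hp : ∀ σ, p σ ∈ S) :
    ∑ σ : Fin n → Bool, |∑ i, boolSign (σ i) * x (p σ) i| ≤
      2 ^ n * (r * Real.sqrt (2 * Real.log (2 * S.card))) := by
  set f : (Fin n → Bool) → ℝ := fun σ => |∑ i, boolSign (σ i) * x (p σ) i| with hf
  have hc : (1 : ℝ) ≤ S.card := by exact_mod_cast hS.card_pos
  set L := Real.log (2 * S.card) with hL
  have hL0 : 0 < L := Real.log_pos (by linarith)
  set q := Real.sqrt (2 * L) with hq
  have hq0 : 0 < q := Real.sqrt_pos.2 (by linarith)
  have hqq : q ^ 2 = 2 * L := Real.sq_sqrt (by linarith)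
  -- This minimises L/lam + lam·r²/2; the 2 inside `L` pays for exp|y| ≤ exp y + exp(-y).
  set lam := q / r with hlam
  have hlam0 : 0 < lam := by positivity
  have h2n : (0 : ℝ) < 2 ^ n := by positivity
  have hjen : Real.exp (∑ σ, ((2 : ℝ) ^ n)⁻¹ • (lam * f σ)) ≤
      ∑ σ, ((2 : ℝ) ^ n)⁻¹ • Real.exp (lam * f σ) :=
    convexOn_exp.map_sum_le (fun _ _ => by positivity) (by simp) (fun _ _ => Set.mem_univ _)
  have hsum : ∑ σ, Real.exp (lam * f σ) ≤ 2 ^ n * Real.exp (q ^ 2) := by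
    have h1 : ∀ σ, Real.exp (lam * f σ) ≤
        ∑ s ∈ S, (Real.exp (∑ i, boolSign (σ i) * (lam * x s i)) +
          Real.exp (∑ i, boolSign (σ i) * (-lam * x s i))) := by
      intro σ
      refine le_trans ?_ (Finset.single_le_sum (f := fun s =>
        Real.exp (∑ i, boolSign (σ i) * (lam * x s i)) +
          Real.exp (∑ i, boolSign (σ i) * (-lam * x s i))) (fun s _ => by positivity) (hp σ))
      have e1 : ∀ μ : ℝ, ∑ i, boolSign (σ i) * (μ * x (p σ) i) =
          μ * ∑ i, boolSign (σ i) * x (p σ) i := by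
        intro μ; rw [Finset.mul_sum]; exact Finset.sum_congr rfl fun i _ => by ring
      simp only [e1, hf]
      rcases abs_cases (∑ i, boolSign (σ i) * x (p σ) i) with ⟨h, _⟩ | ⟨h, _⟩ <;> rw [h]
      · linarith [Real.exp_pos (-lam * ∑ i, boolSign (σ i) * x (p σ) i)]
      · rw [mul_neg, ← neg_mul]
        linarith [Real.exp_pos (lam * ∑ i, boolSign (σ i) * x (p σ) i)]
    have h2 : ∀ s ∈ S, ∀ μ : ℝ, μ ^ 2 = lam ^ 2 →
        ∑ σ : Fin n → Bool, Real.exp (∑ i, boolSign (σ i) * (μ * x s i)) ≤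
          2 ^ n * Real.exp (q ^ 2 / 2) := by
      intro s hs μ hμ
      refine (sum_exp_signs _).trans ?_
      gcongr
      simp only [mul_pow, ← Finset.mul_sum, hμ]
      calc lam ^ 2 * ∑ i, x s i ^ 2 ≤ lam ^ 2 * r ^ 2 := by gcongr; exact hx s hs
        _ = q ^ 2 := by rw [hlam]; field_simp
    calc ∑ σ, Real.exp (lam * f σ) ≤ ∑ σ : Fin n → Bool, ∑ s ∈ S, (Real.exp (∑ i, boolSign (σ i) * (lam * x s i)) +
          Real.exp (∑ i, boolSign (σ i) * (-lam * x s i))) := Finset.sum_le_sum fun σ _ => h1 σ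
      _ = ∑ s ∈ S, (∑ σ : Fin n → Bool, Real.exp (∑ i, boolSign (σ i) * (lam * x s i)) +
          ∑ σ : Fin n → Bool, Real.exp (∑ i, boolSign (σ i) * (-lam * x s i))) := by
        rw [Finset.sum_comm]; simp only [Finset.sum_add_distrib]
      _ ≤ ∑ s ∈ S, (2 ^ n * Real.exp (q ^ 2 / 2) + 2 ^ n * Real.exp (q ^ 2 / 2)) :=
        Finset.sum_le_sum fun s hs => add_le_add (h2 s hs lam rfl) (h2 s hs (-lam) (neg_sq lam))
      _ = 2 ^ n * ((2 * S.card) * Real.exp (q ^ 2 / 2)) := by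
        rw [Finset.sum_const, nsmul_eq_mul]; ring
      _ = 2 ^ n * Real.exp (q ^ 2) := by
        have : (2 * S.card : ℝ) = Real.exp L := (Real.exp_log (by linarith)).symm
        rw [this, ← Real.exp_add]
        congr 2; linarith
  simp only [smul_eq_mul, ← Finset.mul_sum] at hjen
  have h3 : ((2 : ℝ) ^ n)⁻¹ * (lam * ∑ σ, f σ) ≤ q ^ 2 := by
    rw [← Real.exp_le_exp]
    refine hjen.trans ?_
    rw [inv_mul_le_iff₀ h2n]
    exact hsum
  rw [inv_mul_le_iff₀ h2n] at h3
  have h4 : lam * ∑ σ, f σ ≤ lam * (2 ^ n * (r * q)) := by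
    refine h3.trans (le_of_eq ?_)
    rw [hlam]; field_simp
  exact le_of_mul_le_mul_left h4 hlam0

/-! ### From bounded functions to level sets -/

theorem integral_level_indicator {B q : ℝ} (hq0 : 0 ≤ q) (hqB : q ≤ B) :
    ∫ c in (0 : ℝ)..B, (Set.Iic q).indicator (fun _ => (1 : ℝ)) c = q := by
  rw [intervalIntegral.integral_of_le (hq0.trans hqB), setIntegral_indicator measurableSet_Iic]
  have : Set.Ioc 0 B ∩ Set.Iic q = Set.Ioc 0 q := by
    ext c; simp only [Set.mem_inter_iff, Set.mem_Ioc, Set.mem_Iic]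
    constructor
    · rintro ⟨⟨h1, _⟩, h3⟩; exact ⟨h1, h3⟩
    · rintro ⟨h1, h2⟩; exact ⟨⟨h1, h2.trans hqB⟩, h2⟩
  rw [this]
  simp [hq0]

/-- A weighted sum of differences of bounded values is controlled by the same sum for the
indicators of upper level sets. -/
theorem abs_sum_le_of_levels {n : ℕ} {B M : ℝ} (hB : 0 ≤ B) (s q q' : Fin n → ℝ)
    (hq : ∀ i, 0 ≤ q i ∧ q i ≤ B) (hq' : ∀ i, 0 ≤ q' i ∧ q' i ≤ B)
    (hM : ∀ c : ℝ, |∑ i, s i * ((if c ≤ q i then 1 else 0) - (if c ≤ q' i then 1 else 0))| ≤ M) :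
    |∑ i, s i * (q i - q' i)| ≤ B * M := by
  have hint : ∀ y : ℝ, IntervalIntegrable ((Set.Iic y).indicator fun _ => (1 : ℝ)) volume 0 B := by
    intro y
    rw [intervalIntegrable_iff]
    exact (integrableOn_const (by simp)).indicator measurableSet_Iic
  have h1 : ∑ i, s i * (q i - q' i) = ∫ c in (0 : ℝ)..B, ∑ i, s i *
      ((Set.Iic (q i)).indicator (fun _ => (1 : ℝ)) c -
        (Set.Iic (q' i)).indicator (fun _ => (1 : ℝ)) c) := by
    rw [intervalIntegral.integral_finsetSum
      fun i _ => ((hint (q i)).sub (hint (q' i))).const_mul (s i)]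
    refine Finset.sum_congr rfl fun i _ => ?_
    rw [intervalIntegral.integral_const_mul, intervalIntegral.integral_sub (hint _) (hint _),
      integral_level_indicator (hq i).1 (hq i).2, integral_level_indicator (hq' i).1 (hq' i).2]
  have h2 := intervalIntegral.norm_integral_le_of_norm_le_const (a := 0) (b := B) (C := M)
    (f := fun c => ∑ i, s i * ((Set.Iic (q i)).indicator (fun _ => (1 : ℝ)) c -
        (Set.Iic (q' i)).indicator (fun _ => (1 : ℝ)) c)) (fun c _ => by
      have := hM c
      simpa only [Set.indicator, Set.mem_Iic, Real.norm_eq_abs] using this)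
  rw [← h1, Real.norm_eq_abs, sub_zero, abs_of_nonneg hB] at h2
  linarith

/-! ### Paired differences and chaining -/

/-- The difference of the indicators of `A` at the paired positions `i` and `n + i`. -/
noncomputable def traceDiff {n : ℕ} (A : Finset (Fin (n + n))) (i : Fin n) : ℝ :=
  (if Fin.castAdd n i ∈ A then 1 else 0) - (if Fin.natAdd n i ∈ A then 1 else 0)

theorem sum_traceDiff_sq_le {n : ℕ} (A : Finset (Fin (n + n))) :
    ∑ i, traceDiff A i ^ 2 ≤ n := by
  have : ∀ i ∈ Finset.univ, traceDiff A i ^ 2 ≤ 1 := by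
    intro i _
    unfold traceDiff
    split_ifs <;> norm_num
  simpa using Finset.sum_le_sum this

/-- The factor 2 is (x - y)² ≤ 2(x² + y²), attained when both positions of a pair change with
opposite effect. -/
theorem sum_traceDiff_sub_sq_le {n : ℕ} (A A' : Finset (Fin (n + n))) :
    ∑ i, (traceDiff A i - traceDiff A' i) ^ 2 ≤ 2 * (symmDiff A A').card := by
  have h1 : ((symmDiff A A').card : ℝ) = ∑ j, if j ∈ symmDiff A A' then (1 : ℝ) else 0 := by
    simp
  rw [h1, Fin.sum_univ_add, ← Finset.sum_add_distrib, Finset.mul_sum]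
  refine Finset.sum_le_sum fun i _ => ?_
  simp only [traceDiff, Finset.mem_symmDiff]
  by_cases a1 : Fin.castAdd n i ∈ A <;> by_cases a2 : Fin.natAdd n i ∈ A <;>
    by_cases a3 : Fin.castAdd n i ∈ A' <;> by_cases a4 : Fin.natAdd n i ∈ A' <;>
    simp [-Fin.natAdd_eq_addNat, a1, a2, a3, a4] <;> norm_num

/-- Two-step chaining for the Rademacher averages over the traces of level sets. -/
theorem sum_signs_levelFamily_le {𝒵 Λ : Type*} {Q : 𝒵 → Λ → ℝ} {h n : ℕ}
    (hVC : vcDim Q ≤ h) (hh : 1 ≤ h) (hhn : h ≤ n) (z : Fin (n + n) → 𝒵) {ε : ℝ} (hε : 0 < ε)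
    {t : ℕ} (ht1 : 1 ≤ t) (ht : (2 * Real.exp 1 * t) ^ 2 < Real.exp (ε * t))
    (p : (Fin n → Bool) → Finset (Fin (n + n))) (hp : ∀ σ, p σ ∈ levelFamily Q z) :
    ∑ σ : Fin n → Bool, |∑ i, boolSign (σ i) * traceDiff (p σ) i| ≤
      2 ^ n * (Real.sqrt n * Real.sqrt (2 * Real.log (2 * (Real.exp 1 * t) ^ h)) +
        Real.sqrt (4 * ε * n) *
          Real.sqrt (2 * Real.log (2 * (2 * n * Real.exp 1 / h) ^ h))) := by
  have hn1 : 1 ≤ n := hh.trans hhn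
  have hn0 : (0 : ℝ) < n := by exact_mod_cast hn1
  have : Nonempty (Fin (n + n)) := ⟨⟨0, by omega⟩⟩
  obtain ⟨G, hGF, hsep, hcov⟩ := exists_separated_net
    (fun A A' : Finset (Fin (n + n)) =>
      ((symmDiff A A').card : ℝ) < ε * Fintype.card (Fin (n + n)))
    (fun A => by simp only [symmDiff_self, Finset.bot_eq_empty, Finset.card_empty, Nat.cast_zero,
      Fintype.card_fin]; push_cast; positivity)
    (fun A A' => by rw [symmDiff_comm]; exact id) (levelFamily Q z)
  have hGcard := card_separated_le hVC hh z ht1 ht hGF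
    (fun A hA A' hA' hne => not_lt.1 (hsep A hA A' hA' hne))
  choose! π hπG hπ using hcov
  have hF : (levelFamily Q z).Nonempty := ⟨_, hp fun _ => true⟩
  have hG : G.Nonempty := ⟨_, hπG _ (hp fun _ => true)⟩
  have hFcard := card_levelFamily_le hVC hh (by simp; omega) z
  have hFeq : Real.exp 1 * (Fintype.card (Fin (n + n)) : ℝ) / h = 2 * n * Real.exp 1 / h := by
    simp only [Fintype.card_fin]; push_cast; ring
  rw [hFeq] at hFcard
  have h1 := sum_signs_le G hG traceDiff (r := Real.sqrt n) (Real.sqrt_pos.2 hn0)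
    (fun A _ => by rw [Real.sq_sqrt hn0.le]; exact sum_traceDiff_sq_le A)
    (fun σ => π (p σ)) (fun σ => hπG _ (hp σ))
  -- The squared radius 4εn is twice the net's mesh ε · 2n.
  have h2 := sum_signs_le (levelFamily Q z) hF (fun A i => traceDiff A i - traceDiff (π A) i)
    (r := Real.sqrt (4 * ε * n)) (Real.sqrt_pos.2 (by positivity))
    (fun A hA => by
      rw [Real.sq_sqrt (by positivity)]
      refine (sum_traceDiff_sub_sq_le A (π A)).trans ?_
      have := hπ A hA
      simp only [Fintype.card_fin, Nat.cast_add] at this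
      linarith) p hp
  have h3 : ∀ σ : Fin n → Bool, |∑ i, boolSign (σ i) * traceDiff (p σ) i| ≤
      |∑ i, boolSign (σ i) * traceDiff (π (p σ)) i| +
        |∑ i, boolSign (σ i) * (traceDiff (p σ) i - traceDiff (π (p σ)) i)| := by
    intro σ
    refine le_trans (le_of_eq ?_) (abs_add_le _ _)
    rw [← Finset.sum_add_distrib]
    congr 1
    exact Finset.sum_congr rfl fun i _ => by ring
  calc _ ≤ _ := Finset.sum_le_sum fun σ _ => h3 σ
    _ = _ := Finset.sum_add_distrib
    _ ≤ _ := add_le_add h1 h2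
    _ ≤ _ := by
      rw [mul_add]
      gcongr

/-! ### Symmetrization -/

/-- The exchange of `i` and `n + i` in the double sample where `σ i` is false. -/
def swapIndex {n : ℕ} (σ : Fin n → Bool) : Fin (n + n) → Fin (n + n) :=
  Fin.addCases (fun i => if σ i then Fin.castAdd n i else Fin.natAdd n i)
    (fun i => if σ i then Fin.natAdd n i else Fin.castAdd n i)

theorem swapIndex_castAdd {n : ℕ} (σ : Fin n → Bool) (i : Fin n) :
    swapIndex σ (Fin.castAdd n i) = if σ i then Fin.castAdd n i else Fin.natAdd n i :=
  Fin.addCases_left (motive := fun _ => Fin (n + n)) i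

theorem swapIndex_natAdd {n : ℕ} (σ : Fin n → Bool) (i : Fin n) :
    swapIndex σ (Fin.natAdd n i) = if σ i then Fin.natAdd n i else Fin.castAdd n i :=
  Fin.addCases_right (motive := fun _ => Fin (n + n)) i

theorem swapIndex_involutive {n : ℕ} (σ : Fin n → Bool) : Function.Involutive (swapIndex σ) := by
  intro j
  refine Fin.addCases (fun i => ?_) (fun i => ?_) j <;> cases hσ : σ i <;>
    simp [-Fin.natAdd_eq_addNat, swapIndex_castAdd, swapIndex_natAdd, hσ]

theorem empLoss_swapIndex {𝒵 Λ : Type*} (Q : 𝒵 → Λ → ℝ) {n : ℕ} (σ : Fin n → Bool)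
    (z : Fin (n + n) → 𝒵) (a : Λ) :
    empLoss₁ Q (fun j => z (swapIndex σ j)) a - empLoss₂ Q (fun j => z (swapIndex σ j)) a =
      1 / n * ∑ i, boolSign (σ i) * (Q (z (Fin.castAdd n i)) a - Q (z (Fin.natAdd n i)) a) := by
  rw [empLoss₁, empLoss₂, ← mul_sub, ← Finset.sum_sub_distrib]
  congr 1
  refine Finset.sum_congr rfl fun i _ => ?_
  cases hσ : σ i <;>
    simp [-Fin.natAdd_eq_addNat, swapIndex_castAdd, swapIndex_natAdd, boolSign, hσ]

/-- The supremum over an arbitrary `Λ` need not be measurable; superadditivity of the lower integral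
holds regardless, and is the direction needed. -/
theorem sum_lintegral_le {Ω γ : Type*} [MeasurableSpace Ω] (μ : Measure Ω) (S : Finset γ)
    (f : γ → Ω → ℝ≥0∞) : ∑ s ∈ S, ∫⁻ x, f s x ∂μ ≤ ∫⁻ x, ∑ s ∈ S, f s x ∂μ := by
  classical
  induction S using Finset.induction_on with
  | empty => simp
  | insert a S ha ih =>
    simp only [Finset.sum_insert ha]
    exact (add_le_add le_rfl ih).trans (le_lintegral_add _ _)

/-- Symmetrization: a bound for all Rademacher averages bounds the expected supremum. -/
theorem expSupDiff_le_of_signs {𝒵 Λ : Type*} [MeasurableSpace 𝒵] (P : Measure 𝒵)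
    [IsProbabilityMeasure P] (Q : 𝒵 → Λ → ℝ) (n : ℕ) (C : ℝ≥0∞)
    (hC : ∀ z : Fin (n + n) → 𝒵, ∑ σ : Fin n → Bool, ⨆ a : Λ, ENNReal.ofReal
      |1 / n * ∑ i, boolSign (σ i) * (Q (z (Fin.castAdd n i)) a - Q (z (Fin.natAdd n i)) a)| ≤
        2 ^ n * C) :
    expSupDiff P Q n ≤ C := by
  have hswap : ∀ σ : Fin n → Bool, expSupDiff P Q n =
      ∫⁻ z : Fin (n + n) → 𝒵, (⨆ a : Λ, ENNReal.ofReal |1 / n * ∑ i, boolSign (σ i) *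
        (Q (z (Fin.castAdd n i)) a - Q (z (Fin.natAdd n i)) a)|)
          ∂(Measure.pi fun _ : Fin (n + n) => P) := by
    intro σ
    have hmp := measurePreserving_arrowCongr' (fun _ : Fin (n + n) => P)
      (fun _ : Fin (n + n) => P) (swapIndex_involutive σ).toPerm.symm (MeasurableEquiv.refl 𝒵)
      (fun _ => MeasurePreserving.id P)
    rw [expSupDiff, ← hmp.lintegral_comp_emb (MeasurableEquiv.measurableEmbedding _)]
    refine lintegral_congr fun z => ?_
    refine iSup_congr fun a => ?_
    rw [← empLoss_swapIndex]
    rfl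
  have h1 : 2 ^ n * expSupDiff P Q n ≤ 2 ^ n * C := by
    calc 2 ^ n * expSupDiff P Q n = ∑ _σ : Fin n → Bool, expSupDiff P Q n := by simp
      _ ≤ _ := (Finset.sum_congr rfl fun σ _ => hswap σ).le.trans (sum_lintegral_le _ _ _)
      _ ≤ ∫⁻ _ : Fin (n + n) → 𝒵, 2 ^ n * C ∂(Measure.pi fun _ : Fin (n + n) => P) :=
        lintegral_mono hC
      _ = _ := by simp
  exact (ENNReal.mul_le_mul_iff_right (by simp) (by simp)).1 h1

/-! ### The uniform bound and its asymptotics -/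

theorem expSupDiff_le_chaining {𝒵 Λ : Type*} [MeasurableSpace 𝒵] [Nonempty Λ] (P : Measure 𝒵)
    [IsProbabilityMeasure P] {Q : 𝒵 → Λ → ℝ} {B : ℝ} (hB : 0 ≤ B)
    (hQ : ∀ z a, 0 ≤ Q z a ∧ Q z a ≤ B) {h n : ℕ}
    (hVC : vcDim Q ≤ h) (hh : 1 ≤ h) (hhn : h ≤ n) {ε : ℝ} (hε : 0 < ε)
    {t : ℕ} (ht1 : 1 ≤ t) (ht : (2 * Real.exp 1 * t) ^ 2 < Real.exp (ε * t)) :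
    expSupDiff P Q n ≤ ENNReal.ofReal (B / n *
      (Real.sqrt n * Real.sqrt (2 * Real.log (2 * (Real.exp 1 * t) ^ h)) +
        Real.sqrt (4 * ε * n) *
          Real.sqrt (2 * Real.log (2 * (2 * n * Real.exp 1 / h) ^ h)))) := by
  refine expSupDiff_le_of_signs P Q n _ fun z => ?_
  have hF : (levelFamily Q z).Nonempty := by
    classical
    obtain ⟨a⟩ := ‹Nonempty Λ›
    exact ⟨Finset.univ.filter fun i => 0 ≤ Q (z i) a, mem_levelFamily.2 ⟨a, 0, by simp⟩⟩
  -- Only finitely many traces occur, so the supremum over levels is attained, at a trace depending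
  -- on `σ`.
  choose p hpF hpmax using fun σ : Fin n → Bool => Finset.exists_max_image (levelFamily Q z)
    (fun A => |∑ i, boolSign (σ i) * traceDiff A i|) hF
  have hsup : ∀ σ : Fin n → Bool, (⨆ a : Λ, ENNReal.ofReal
      |1 / n * ∑ i, boolSign (σ i) * (Q (z (Fin.castAdd n i)) a - Q (z (Fin.natAdd n i)) a)|) ≤
        ENNReal.ofReal (B / n * |∑ i, boolSign (σ i) * traceDiff (p σ) i|) := by
    intro σ
    refine iSup_le fun a => ENNReal.ofReal_le_ofReal ?_
    rw [abs_mul, abs_of_nonneg (by positivity : (0 : ℝ) ≤ 1 / n)]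
    have := abs_sum_le_of_levels hB (fun i => boolSign (σ i)) (fun i => Q (z (Fin.castAdd n i)) a)
      (fun i => Q (z (Fin.natAdd n i)) a) (fun i => hQ _ _) (fun i => hQ _ _)
      (M := |∑ i, boolSign (σ i) * traceDiff (p σ) i|) (fun c => by
        classical
        have := hpmax σ (Finset.univ.filter fun i => c ≤ Q (z i) a)
          (mem_levelFamily.2 ⟨a, c, by simp⟩)
        simpa [traceDiff] using this)
    calc _ ≤ 1 / n * (B * |∑ i, boolSign (σ i) * traceDiff (p σ) i|) := by gcongr
      _ = _ := by ring
  have h2 := sum_signs_levelFamily_le hVC hh hhn z hε ht1 ht p hpF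
  calc _ ≤ ∑ σ : Fin n → Bool,
        ENNReal.ofReal (B / n * |∑ i, boolSign (σ i) * traceDiff (p σ) i|) :=
      Finset.sum_le_sum fun σ _ => hsup σ
    _ = ENNReal.ofReal (B / n * ∑ σ : Fin n → Bool,
          |∑ i, boolSign (σ i) * traceDiff (p σ) i|) := by
      rw [Finset.mul_sum, ENNReal.ofReal_sum_of_nonneg fun σ _ => by positivity]
    _ ≤ _ := ENNReal.ofReal_le_ofReal (mul_le_mul_of_nonneg_left h2 (by positivity))
    _ = _ := by
      rw [mul_left_comm, ENNReal.ofReal_mul (by positivity)]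
      congr 1
      rw [ENNReal.ofReal_pow (by norm_num)]
      simp

/-- Exponentials beat squares; what matters is that `t` depends on `ε` only, not on `n` or `h`. -/
theorem exists_sample_factor {ε : ℝ} (hε : 0 < ε) :
    ∃ t : ℕ, 1 ≤ t ∧ (2 * Real.exp 1 * t) ^ 2 < Real.exp (ε * t) := by
  have h1 := (isLittleO_pow_exp_pos_mul_atTop 2 hε).comp_tendsto tendsto_natCast_atTop_atTop
  have h2 := h1.def (c := ((2 * Real.exp 1) ^ 2 + 1)⁻¹) (by positivity)
  obtain ⟨t, ht, ht1⟩ := (h2.and (eventually_ge_atTop 1)).exists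
  refine ⟨t, ht1, ?_⟩
  have ht0 : (0 : ℝ) < t := by exact_mod_cast ht1
  simp only [Function.comp_apply, norm_pow, Real.norm_eq_abs, Real.abs_exp, Nat.abs_cast] at ht
  rw [← div_eq_inv_mul, le_div_iff₀ (by positivity)] at ht
  have : (0 : ℝ) < (t : ℝ) ^ 2 := by positivity
  rw [mul_pow]
  linarith

/-- For classes of uniformly bounded functions the expected supremum is
`o(√((h / n) ln (2ne / h)))` as `n / h → ∞`, uniformly over all classes and laws. -/
theorem exists_expSupDiff_le {B η : ℝ} (hB : 0 < B) (hη : 0 < η) :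
    ∃ R : ℝ, ∀ {𝒵 : Type*} {Λ : Type*} [MeasurableSpace 𝒵] [Nonempty Λ] (P : Measure 𝒵)
      [IsProbabilityMeasure P] {Q : 𝒵 → Λ → ℝ} (_ : ∀ z a, 0 ≤ Q z a ∧ Q z a ≤ B) {h n : ℕ}
      (_ : vcDim Q ≤ h) (_ : 1 ≤ h) (_ : R ≤ (n : ℝ) / h),
      expSupDiff P Q n ≤ ENNReal.ofReal
        (η * Real.sqrt ((h : ℝ) / n * Real.log (2 * n * Real.exp 1 / h))) := by
  -- Chosen so that the second chaining step contributes exactly η/2 times √L.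
  set ε : ℝ := (η / (8 * B)) ^ 2 with hε
  have hε0 : 0 < ε := by positivity
  obtain ⟨t, ht1, ht⟩ := exists_sample_factor hε0
  have ht0 : (1 : ℝ) ≤ t := by exact_mod_cast ht1
  have he : (1 : ℝ) ≤ Real.exp 1 := Real.one_le_exp zero_le_one
  have het : (1 : ℝ) ≤ Real.exp 1 * t := one_le_mul_of_one_le_of_one_le he ht0
  set a : ℝ := Real.log (2 * (Real.exp 1 * t)) with ha
  have ha0 : 0 ≤ a := Real.log_nonneg (by linarith)
  -- The net contributes (η/2)·b, and n/h ≥ exp(b²) forces b ≤ √L.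
  set b : ℝ := 2 * B * Real.sqrt (2 * a) / η with hb
  refine ⟨Real.exp (b ^ 2), ?_⟩
  intro 𝒵 Λ _ _ P _ Q hQ h n hVC hh hR
  have hh0 : (0 : ℝ) < h := by exact_mod_cast hh
  have hnh1 : (1 : ℝ) ≤ n / h := (Real.one_le_exp (sq_nonneg b)).trans hR
  have hhn : h ≤ n := by
    rw [le_div_iff₀ hh0, one_mul] at hnh1; exact_mod_cast hnh1
  have hn0 : (0 : ℝ) < n := by exact_mod_cast hh.trans hhn
  refine (expSupDiff_le_chaining P hB.le hQ hVC hh hhn hε0 ht1 ht).trans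
    (ENNReal.ofReal_le_ofReal ?_)
  set x : ℝ := 2 * n * Real.exp 1 / h with hx
  have hxe : x = 2 * Real.exp 1 * (n / h) := by rw [hx]; ring
  have hx2 : 2 ≤ x := by rw [hxe]; nlinarith
  set L : ℝ := Real.log x with hL
  have hbL : b ^ 2 ≤ L := by
    rw [hL, Real.le_log_iff_exp_le (by linarith), hxe]
    nlinarith
  have hL0 : 0 ≤ L := (sq_nonneg b).trans hbL
  have hlog2 : Real.log 2 ≤ L := Real.log_le_log (by norm_num) hx2
  have hpow : ∀ y : ℝ, 1 ≤ y → Real.log (2 * y ^ h) ≤ h * (Real.log 2 + Real.log y) := by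
    intro y hy
    rw [Real.log_mul (by norm_num) (by positivity), Real.log_pow, mul_add]
    have h1 : (1 : ℝ) ≤ h := by exact_mod_cast hh
    have := Real.log_nonneg (by norm_num : (1 : ℝ) ≤ 2)
    nlinarith
  have hl1 : Real.log (2 * (Real.exp 1 * t) ^ h) ≤ h * a := by
    refine (hpow _ het).trans (le_of_eq ?_)
    rw [ha, Real.log_mul (x := 2) (by norm_num) (by positivity)]
  have hl2 : Real.log (2 * x ^ h) ≤ h * (2 * L) := by
    refine (hpow x (by linarith)).trans ?_
    gcongr
    linarith
  have hs1 : Real.sqrt n * Real.sqrt (2 * Real.log (2 * (Real.exp 1 * t) ^ h)) ≤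
      Real.sqrt n * Real.sqrt h * Real.sqrt (2 * a) := by
    rw [mul_assoc, ← Real.sqrt_mul hh0.le]
    exact mul_le_mul_of_nonneg_left (Real.sqrt_le_sqrt (by linarith)) (Real.sqrt_nonneg _)
  have hs2 : Real.sqrt (4 * ε * n) * Real.sqrt (2 * Real.log (2 * x ^ h)) ≤
      Real.sqrt n * Real.sqrt h * (4 * (η / (8 * B)) * Real.sqrt L) := by
    have e1 : Real.sqrt (4 * ε * n) = 2 * (η / (8 * B)) * Real.sqrt n := by
      rw [hε, Real.sqrt_mul (by positivity)]
      congr 1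
      rw [Real.sqrt_eq_iff_mul_self_eq (by positivity) (by positivity)]
      ring
    have e2 : Real.sqrt (2 * Real.log (2 * x ^ h)) ≤ Real.sqrt h * (2 * Real.sqrt L) := by
      have : Real.sqrt h * (2 * Real.sqrt L) = Real.sqrt (h * (4 * L)) := by
        rw [Real.sqrt_mul hh0.le, Real.sqrt_mul (by norm_num)]
        congr 2
        rw [eq_comm, Real.sqrt_eq_iff_mul_self_eq (by norm_num) (by norm_num)]
        norm_num
      rw [this]
      exact Real.sqrt_le_sqrt (by linarith)
    rw [e1]
    calc _ ≤ 2 * (η / (8 * B)) * Real.sqrt n * (Real.sqrt h * (2 * Real.sqrt L)) := by gcongr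
      _ = _ := by ring
  have hbs : b ≤ Real.sqrt L := Real.le_sqrt_of_sq_le hbL
  have hkey : B * (Real.sqrt (2 * a) + 4 * (η / (8 * B)) * Real.sqrt L) ≤ η * Real.sqrt L := by
    have e1 : B * Real.sqrt (2 * a) = η / 2 * b := by rw [hb]; field_simp
    have e2 : B * (4 * (η / (8 * B)) * Real.sqrt L) = η / 2 * Real.sqrt L := by
      field_simp; ring
    rw [mul_add, e1, e2]
    nlinarith
  have hsq : Real.sqrt (h / n * L) = Real.sqrt n * Real.sqrt h / n * Real.sqrt L := by
    rw [Real.sqrt_mul (by positivity), Real.sqrt_div hh0.le]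
    congr 1
    rw [div_eq_div_iff (by positivity) (by positivity)]
    nth_rewrite 1 [← Real.mul_self_sqrt hn0.le]
    ring
  calc _ ≤ B / n * (Real.sqrt n * Real.sqrt h * Real.sqrt (2 * a) +
        Real.sqrt n * Real.sqrt h * (4 * (η / (8 * B)) * Real.sqrt L)) := by gcongr
    _ = Real.sqrt n * Real.sqrt h / n *
        (B * (Real.sqrt (2 * a) + 4 * (η / (8 * B)) * Real.sqrt L)) := by ring
    _ ≤ Real.sqrt n * Real.sqrt h / n * (η * Real.sqrt L) := by gcongr
    _ = _ := by rw [hsq]; ring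

end EmpLoss

theorem theorem2 {ι : Type*} {l : Filter ι}
    {𝒵 : ι → Type*} [∀ k, MeasurableSpace (𝒵 k)]
    (P : ∀ k, Measure (𝒵 k)) [∀ k, IsProbabilityMeasure (P k)]
    {Λ : ι → Type*} (Q : ∀ k, 𝒵 k → Λ k → ℝ)
    (hQmeas : ∀ k α, Measurable fun z => Q k z α)
    (B : ℝ) (hQ : ∀ k z α, 0 ≤ Q k z α ∧ Q k z α ≤ B)
    (δ : ℝ≥0∞) (hδ : 0 < δ) (hD : ∀ k, δ ≤ EmpLoss.tailNormSup (P k) (Q k) 2)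
    (h n m : ι → ℕ)
    (hVC : ∀ k, EmpLoss.vcDim (Q k) = (h k : ℕ∞))
    (hh : Tendsto h l atTop)
    (hn : Tendsto (fun k => (n k : ℝ) / (h k : ℝ)) l atTop)
    (hm : Tendsto m l atTop)
    (hlogm : (fun k => Real.log (m k)) =o[l] (fun k => (n k : ℝ))) :
    ∀ᶠ k in l,
      EmpLoss.expSupDiff (P k) (Q k) (n k) ≤
        min 1 (8 * EmpLoss.tailNormSup (P k) (Q k) 2) *
          ENNReal.ofReal
            (Real.sqrt ((h k : ℝ) / n k * Real.log (2 * n k * Real.exp 1 / h k))) := by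
  set η : ℝ≥0∞ := min 1 (8 * δ) with hη
  have hη1 : η ≤ 1 := min_le_left _ _
  have hηtop : η ≠ ⊤ := ne_top_of_le_ne_top ENNReal.one_ne_top hη1
  have hη0 : 0 < η := lt_min one_pos (ENNReal.mul_pos (by norm_num) hδ.ne')
  have hηr : 0 < η.toReal := ENNReal.toReal_pos hη0.ne' hηtop
  -- `max B 1` supplies a strictly positive bound on the losses.
  obtain ⟨R, hR⟩ := EmpLoss.exists_expSupDiff_le (lt_max_of_lt_right one_pos : 0 < max B 1) hηr
  filter_upwards [hh.eventually_ge_atTop 1, hn.eventually_ge_atTop R] with k hk1 hkR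
  -- Over an empty index set the supremum `tailNormSup` would be 0, below `δ`.
  have hΛ : Nonempty (Λ k) := by
    by_contra hne
    rw [not_nonempty_iff] at hne
    have := hD k
    rw [EmpLoss.tailNormSup, iSup_of_empty] at this
    exact hδ.not_ge this
  refine (hR (P k) (fun z a => ⟨(hQ k z a).1, (hQ k z a).2.trans (le_max_left _ _)⟩)
    (hVC k).le hk1 hkR).trans ?_
  rw [ENNReal.ofReal_mul hηr.le, ENNReal.ofReal_toReal hηtop]
  gcongr
  exact min_le_min le_rfl (mul_le_mul_right (hD k) 8)
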